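/- Let $M$ be a compact, connected smooth manifold without boundary with $H_1(M;\mathbb Z)\cong\mathbb Z^b$, $b>0$, and fix a basis $\Gamma_1,\dots,\Gamma_b$ of $H_1(M;\mathbb Z)$ and smooth closed one-forms $\omega_1,\dots,\omega_b$ on $M$ (for instance harmonic forms for a Riemannian metric) with $\omega_i(\Gamma_j)=\delta_{ij}$. Let $p:\tilde M_a\to M$ be the universal Abelian cover, i.e. the connected covering space corresponding to the commutator subgroup of $\pi_1(M)$, fix a base point $z\in\tilde M_a$, and define $\tilde\iota:\tilde M_a\to\mathbb R^b$ by $\tilde\iota_i(\tilde x)=\int_\gamma p^*\omega_i$, where $\gamma$ is any smooth path in $\tilde M_a$ from $z$ to $\tilde x$. Let $f:M\to M$ be continuous, let $\tilde f:\tilde M_a\to\tilde M_a$ be a (continuous) lift of $f$, let $A\in M_b(\mathbb Z)$ be the matrix of $f_*:H_1(M;\mathbb Z)\to H_1(M;\mathbb Z)$ in the basis $(\Gamma_j)$, and let $\Phi_A:\mathbb T^b\to\mathbb T^b$, $\mathbb T^b=\mathbb R^b/\mathbb Z^b$, be the induced toral endomorphism. Assume that $f$ is $H_1$-expanding: every complex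 eigenvalue $\mu$ of $A$ satisfies $|\mu|>1$. Then there is $\lambda$ with $\rho(A^{-1})<1/\lambda<1$ (where $\rho$ is the spectral radius), and for every such $\lambda$ there is an adapted norm, i.e. a norm $\|\cdot\|$ on $\mathbb R^b$ whose operator norm satisfies $\|A^{-1}\|<1/\lambda$. For every such $\lambda$ and every adapted norm $\|\cdot\|$, the function $\tilde\sigma(\tilde x)=\tilde\iota(\tilde f(\tilde x))-A\,\tilde\iota(\tilde x)$ is bounded on $\tilde M_a$, and with $$c(f)=\sup_{\tilde x\in\tilde M_a}\|\tilde\sigma(\tilde x)\|,\qquad \delta(f)=\frac{c(f)}{\lambda-1},$$ the following hold. 1. For every $\tilde x_0\in\tilde M_a$ there is a unique $\tilde y\in\mathbb R^b$ such that $$\|\tilde\iota(\tilde f^{\,i}(\tilde x_0))-A^i\tilde y\|\le\delta(f)\qquad\text{for all } i\ge 0 .$$ 2. Consequently, for these $\tilde x_0$ and $\tilde y$, the orbit of $p(\tilde x_0)$ under $f$ globally shadows the orbit of $\tilde y+\mathbb Z^b$ under $\Phi_A$ with constant $\delta(f)$; in particular, for every $x\in M$ the orbit of $x$ under $f$ globally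 shadows an orbit of $\Phi_A$ with constant $\delta(f)$. Here $(x,f)$ is said to globally shadow $(y,\Phi_A)$ with constant $K$ if there are lifts $\tilde x'\in\tilde M_a$ of $x$, $\tilde y'\in\mathbb R^b$ of $y$ and $\tilde f'$ of $f$ with $\|\tilde\iota(\tilde f'^{\,n}(\tilde x'))-A^n\tilde y'\|\le K$ for all $n\ge0$. -/

import Mathlib

open scoped Manifold ContDiff Simplicial
open CategoryTheory

universe u v

noncomputable section

namespace GlobalShadowing

/-! ### First integral singular homology and the class of a loop -/

/-- The coefficient group `ℤ`, in the universe of the space. -/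
abbrev coeff : ModuleCat.{u} ℤ := ModuleCat.of ℤ (ULift.{u} ℤ)

/-- `H₁(M; ℤ)`, singular homology. -/
abbrev H1 (M : Type u) [TopologicalSpace M] : ModuleCat.{u} ℤ :=
  ((AlgebraicTopology.singularHomologyFunctor (ModuleCat.{u} ℤ) 1).obj coeff).obj (TopCat.of M)

/-- The map `f_* : H₁(M; ℤ) → H₁(M; ℤ)` induced by a continuous map `f`. -/
def H1map {M : Type u} [TopologicalSpace M] (f : C(M, M)) : H1 M →ₗ[ℤ] H1 M :=
  (((AlgebraicTopology.singularHomologyFunctor (ModuleCat.{u} ℤ) 1).obj coeff).map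
    (TopCat.ofHom f)).hom

/-- A path, as a morphism from the unit interval. -/
def pathHom {M : Type u} [TopologicalSpace M] {x y : M} (γ : Path x y) :
    TopCat.I.{u} ⟶ TopCat.of M :=
  TopCat.ofHom (γ.toContinuousMap.comp ⟨ULift.down, continuous_uliftDown⟩)

/-- The singular `1`-simplex given by a path. -/
def pathSimplex {M : Type u} [TopologicalSpace M] {x y : M} (γ : Path x y) :
    TopCat.toSSet.obj (TopCat.of M) _⦋1⦌ :=
  TopCat.toSSetObj₁Equiv.symm (pathHom γ)

/-- The `1`-simplex given by a loop is a cycle. -/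
theorem loop_cycle {M : Type u} [TopologicalSpace M] {x : M} (γ : Path x x) :
    (TopCat.toSSet.obj (TopCat.of M)).ιChainComplex (R := coeff) (pathSimplex γ) ≫
      ((TopCat.toSSet.obj (TopCat.of M)).chainComplex coeff).d 1 0 = 0 := by
  have h0 : (TopCat.toSSet.obj (TopCat.of M)).δ 0 (pathSimplex γ) =
      (TopCat.toSSet.obj (TopCat.of M)).δ 1 (pathSimplex γ) := by
    unfold pathSimplex
    rw [TopCat.δ_zero_toSSetObj₁Equiv.symm, TopCat.δ_one_toSSetObj₁Equiv.symm]
    exact congrArg _ (γ.target.trans γ.source.symm)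
  rw [SSet.ιChainComplex_d, Fin.sum_univ_two, h0]
  simp

/-- The class in `H₁(M; ℤ)` of a loop. -/
def loopClass {M : Type u} [TopologicalSpace M] {x : M} (γ : Path x x) : H1 M :=
  (((TopCat.toSSet.obj (TopCat.of M)).chainComplex coeff).liftCycles
      ((TopCat.toSSet.obj (TopCat.of M)).ιChainComplex (R := coeff) (pathSimplex γ)) 0 (by simp)
      (loop_cycle γ) ≫
    ((TopCat.toSSet.obj (TopCat.of M)).chainComplex coeff).homologyπ 1).hom (ULift.up 1)

/-- The integer matrix of `f_*` in a basis `Γ` of `H₁(M; ℤ)`: `f_* Γⱼ = ∑ᵢ Aᵢⱼ Γᵢ`. -/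
def homologyMatrix {b : ℕ} {M : Type u} [TopologicalSpace M]
    (Γ : Module.Basis (Fin b) ℤ (H1 M)) (f : C(M, M)) : Matrix (Fin b) (Fin b) ℤ :=
  LinearMap.toMatrix Γ Γ (H1map f)

/-! ### One-forms and their integrals -/

/-- A one-form on an `m`-dimensional manifold: a covector at each point. -/
abbrev OneForm (m : ℕ) (M : Type u) [TopologicalSpace M]
    [ChartedSpace (EuclideanSpace ℝ (Fin m)) M] : Type u :=
  (x : M) → TangentSpace (𝓡 m) x →L[ℝ] ℝ

section Forms

variable {m : ℕ} {M : Type u} [TopologicalSpace M] [ChartedSpace (EuclideanSpace ℝ (Fin m)) M]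

/-- The coordinate expression of `η` in the chart at `x`, i.e. its pullback by the inverse chart. -/
def OneForm.inChart (η : OneForm m M) (x : M) (e : EuclideanSpace ℝ (Fin m)) :
    EuclideanSpace ℝ (Fin m) →L[ℝ] ℝ :=
  (η ((extChartAt (𝓡 m) x).symm e)).comp
    (mfderiv (𝓡 m) (𝓡 m) (extChartAt (𝓡 m) x).symm e)

/-- `η` is a smooth closed one-form: in every chart its coefficients are `C^∞` and
`dη(v, w) = D_v η(w) - D_w η(v)` vanishes. -/
structure OneForm.IsSmoothClosed (η : OneForm m M) : Prop where
  smooth : ∀ x : M, ContDiffOn ℝ ∞ (η.inChart x) (extChartAt (𝓡 m) x).target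
  closed : ∀ x : M, ∀ e ∈ (extChartAt (𝓡 m) x).target, ∀ v w : EuclideanSpace ℝ (Fin m),
    fderiv ℝ (η.inChart x) e v w = fderiv ℝ (η.inChart x) e w v

/-- The path `γ : [0, 1] → M` is smooth. -/
def IsSmoothPath (m : ℕ) {M : Type u} [TopologicalSpace M]
    [ChartedSpace (EuclideanSpace ℝ (Fin m)) M] {x y : M} (γ : Path x y) : Prop :=
  ContMDiffOn 𝓘(ℝ, ℝ) (𝓡 m) ∞ γ.extend (Set.Icc 0 1)

/-- The line integral `∫_γ η = ∫₀¹ η_{γ(t)}(γ'(t)) dt`. -/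
def OneForm.integral (η : OneForm m M) {x y : M} (γ : Path x y) : ℝ :=
  ∫ t in (0 : ℝ)..1,
    η (γ.extend t) (mfderivWithin 𝓘(ℝ, ℝ) (𝓡 m) γ.extend (Set.Icc 0 1) t (1 : ℝ))

/-- The value `η(c)` of a closed one-form on a homology class `c` is `r`: the integral of `η` over
a smooth loop representing `c` is `r`. (On a connected manifold every class is represented by a
smooth loop, and for closed `η` the integral does not depend on the loop.) -/
def OneForm.HasPeriod (η : OneForm m M) (c : H1 M) (r : ℝ) : Prop :=
  ∃ (x : M) (γ : Path x x), IsSmoothPath m γ ∧ loopClass γ = c ∧ η.integral γ = r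

end Forms

/-! ### The universal Abelian cover, lifts, and the map to `ℝ^b` -/

/-- `p : M' → M` is the universal Abelian cover: the connected covering space corresponding to the
commutator subgroup of the fundamental group, that is, the quotient of the universal cover by the
action of the commutator subgroup. -/
structure IsUniversalAbelianCover {M' : Type v} {M : Type u} [TopologicalSpace M']
    [TopologicalSpace M] (p : C(M', M)) : Prop where
  covering : IsCoveringMap p
  surjective : Function.Surjective p
  pathConnected : PathConnectedSpace M'
  range_eq : ∀ x : M', (FundamentalGroup.map p x).range = commutator (FundamentalGroup M (p x))

/-- `F` is a lift of `f` through `p`. -/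
def IsLift {X Y : Type*} (p : X → Y) (f : Y → Y) (F : X → X) : Prop :=
  ∀ x, p (F x) = f (p x)

open Classical in
/-- The map `ι̃ : M' → ℝ^b`, `ι̃ᵢ(x) = ∫_γ η̃ᵢ`, where `η̃ᵢ = p^* ηᵢ` and `γ` is a smooth path in `M'`
from the base point `z` to `x`. As `p` is a local diffeomorphism, `γ` is smooth if and only if
`p ∘ γ` is, and `∫_γ p^* ηᵢ = ∫_{p ∘ γ} ηᵢ`. The path is chosen; for a connected covering space of
a connected manifold one always exists, so the second branch does not occur. -/
def albanese {b m : ℕ} {M' : Type v} {M : Type u} [TopologicalSpace M'] [TopologicalSpace M]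
    [ChartedSpace (EuclideanSpace ℝ (Fin m)) M] (p : C(M', M)) (η : Fin b → OneForm m M)
    (z x : M') : Fin b → ℝ :=
  if h : ∃ γ : Path z x, IsSmoothPath m (γ.map p.continuous) then
    fun i => (η i).integral (h.choose.map p.continuous)
  else 0

/-! ### Linear algebra: expanding matrices, adapted norms, toral endomorphisms -/

/-- An integer matrix acting on `ℝ^b`. -/
def act {b : ℕ} (A : Matrix (Fin b) (Fin b) ℤ) (y : Fin b → ℝ) : Fin b → ℝ :=
  (A.map (Int.cast : ℤ → ℝ)).mulVec y

/-- All (complex) eigenvalues of `A` are outside the unit circle. -/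
def IsExpanding {b : ℕ} (A : Matrix (Fin b) (Fin b) ℤ) : Prop :=
  ∀ μ : ℂ, Module.End.HasEigenvalue (Matrix.toLin' (A.map (Int.cast : ℤ → ℂ))) μ → 1 < ‖μ‖

/-- `lam` satisfies `ρ(A⁻¹) < 1 / lam < 1`. -/
def IsExpansionConstant {b : ℕ} (A : Matrix (Fin b) (Fin b) ℤ) (lam : ℝ) : Prop :=
  1 < lam ∧ spectralRadius ℂ (A.map (Int.cast : ℤ → ℂ))⁻¹ < ENNReal.ofReal (1 / lam)

/-- `N` is a norm on `ℝ^b` for which the operator norm of `A⁻¹` is less than `1 / lam`. -/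
structure IsAdaptedNorm {b : ℕ} (A : Matrix (Fin b) (Fin b) ℤ) (lam : ℝ)
    (N : Seminorm ℝ (Fin b → ℝ)) : Prop where
  definite : ∀ v, N v = 0 → v = 0
  contracting : ∃ k < 1 / lam, ∀ v, N ((A.map (Int.cast : ℤ → ℝ))⁻¹.mulVec v) ≤ k * N v

/-- The projection `ℝ^b → 𝕋^b = ℝ^b / ℤ^b`. -/
def torusProj {b : ℕ} (y : Fin b → ℝ) : Fin b → UnitAddCircle :=
  fun i => (y i : UnitAddCircle)

/-- The toral endomorphism `Φ_A`. -/
def toralEndo {b : ℕ} (A : Matrix (Fin b) (Fin b) ℤ) (y : Fin b → UnitAddCircle) :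
    Fin b → UnitAddCircle :=
  fun i => ∑ j, A i j • y j

/-- The linear map `A` is a lift of `Φ_A`. -/
theorem isLift_act {b : ℕ} (A : Matrix (Fin b) (Fin b) ℤ) :
    IsLift torusProj (toralEndo A) (act A) := by
  intro y
  funext i
  simp only [torusProj, toralEndo, act, Matrix.mulVec, dotProduct, Matrix.map_apply]
  rw [← QuotientAddGroup.mk'_apply, map_sum]
  refine Finset.sum_congr rfl fun j _ => ?_
  rw [← zsmul_eq_mul, map_zsmul]
  rfl

/-! ### Displacement error and shadowing -/

/-- `σ̃(x) = ι̃(f̃(x)) - A ι̃(x)`. -/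
def sigma {b : ℕ} {M' : Type v} (iota : M' → Fin b → ℝ) (F : M' → M')
    (A : Matrix (Fin b) (Fin b) ℤ) (x : M') : Fin b → ℝ :=
  iota (F x) - act A (iota x)

/-- `c(f) = ‖σ‖`, the supremum of `‖σ̃(x)‖`. -/
def cConst {b : ℕ} {M' : Type v} (iota : M' → Fin b → ℝ) (F : M' → M')
    (A : Matrix (Fin b) (Fin b) ℤ) (N : Seminorm ℝ (Fin b → ℝ)) : ℝ :=
  ⨆ x : M', N (sigma iota F A x)

/-- `δ(f) = c(f) / (lam - 1)`. -/
def deltaConst {b : ℕ} {M' : Type v} (iota : M' → Fin b → ℝ) (F : M' → M')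
    (A : Matrix (Fin b) (Fin b) ℤ) (N : Seminorm ℝ (Fin b → ℝ)) (lam : ℝ) : ℝ :=
  cConst iota F A N / (lam - 1)

/-- The orbits `(x, f̃)` and `(y, A)` shadow with constant `K`:
`‖ι̃(f̃ⁿ(x)) - Aⁿ y‖ ≤ K` for all `n ≥ 0`. -/
def Shadow {b : ℕ} {M' : Type v} (iota : M' → Fin b → ℝ) (F : M' → M')
    (A : Matrix (Fin b) (Fin b) ℤ) (N : Seminorm ℝ (Fin b → ℝ)) (K : ℝ)
    (x : M') (y : Fin b → ℝ) : Prop :=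
  ∀ n : ℕ, N (iota (F^[n] x) - (act A)^[n] y) ≤ K

/-- The orbits `(x, f)` and `(y, Φ)` in the bases globally shadow with constant `K`: there are
lifts of `x`, `y` and `f` that shadow. Here `Φ` is a toral map with the linear lift `A`. -/
def GloballyShadow {b : ℕ} {M' : Type v} {M : Type u} [TopologicalSpace M'] [TopologicalSpace M]
    (p : C(M', M)) (iota : M' → Fin b → ℝ) (f : C(M, M))
    (Φ : (Fin b → UnitAddCircle) → (Fin b → UnitAddCircle)) (A : Matrix (Fin b) (Fin b) ℤ)
    (N : Seminorm ℝ (Fin b → ℝ)) (K : ℝ) (x : M) (y : Fin b → UnitAddCircle) : Prop :=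
  IsLift torusProj Φ (act A) ∧
    ∃ (x' : M') (y' : Fin b → ℝ) (F : C(M', M')),
      p x' = x ∧ torusProj y' = y ∧ IsLift p f F ∧ Shadow iota F A N K x' y'

end GlobalShadowing

end

open GlobalShadowing

/-!
A closed one-form has local primitives that differ by constants, so its germs of primitives form
a covering of `M` on which the monodromy acts by translations of `ℝ`, hence trivially along
commutators. On the universal Abelian cover the forms `p^* ηᵢ` therefore have global primitives,
and these are the components of `ι̃`. Integrals along loops factor through `H₁(M; ℤ)`, where the
dual forms are the coordinates, so moving `x` within a fibre of `p` changes `ι̃(f̃(x))` and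
`A ι̃(x)` by the same vector. The displacement `σ̃` thus descends to the compact space `M` and is
bounded: the sequence `ι̃(f̃ⁿ(x))` is a pseudo-orbit of `A`. As `A` expands an adapted norm by
the factor `lam`, `A⁻ⁿ ι̃(f̃ⁿ(x))` converges geometrically, and its limit is the only point
whose `A`-orbit stays at bounded distance from the sequence.
-/

noncomputable section

namespace GlobalShadowing

open Topology Filter Set
open scoped NNReal Matrix

/-! ### Local primitives and the covering space of their germs -/

/-- A closed one-form on a topological space `M`, given by its local primitives: `prim y` is the
primitive near `y` that vanishes at `y`, and the primitives at nearby points differ by a constant.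
Only the germ of `prim y` at `y` is meaningful. -/
structure LocalPrimitives (M : Type*) [TopologicalSpace M] where
  /-- The primitive at a point. -/
  prim : M → M → ℝ
  compat : ∀ y, ∀ᶠ y' in 𝓝 y, ∀ᶠ w in 𝓝 y', prim y w = prim y y' + prim y' w

namespace LocalPrimitives

variable {M X Y : Type*} [TopologicalSpace M] [TopologicalSpace X] [TopologicalSpace Y]
  (θ : LocalPrimitives M)

theorem prim_self (y : M) : θ.prim y y = 0 := by
  have := (θ.compat y).self_of_nhds.self_of_nhds
  linarith

/-- `h` is a primitive of the pullback `s^* θ`. -/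
def IsPrimitive (s : X → M) (h : X → ℝ) : Prop :=
  ∀ x₀, ∀ᶠ x in 𝓝 x₀, h x = h x₀ + θ.prim (s x₀) (s x)

variable {θ}

theorem IsPrimitive.comp {s : X → M} {h : X → ℝ} (hh : θ.IsPrimitive s h) {φ : Y → X}
    (hφ : Continuous φ) : θ.IsPrimitive (s ∘ φ) (h ∘ φ) :=
  fun y₀ => (hφ.tendsto y₀).eventually (hh (φ y₀))

theorem IsPrimitive.sub_const {s : X → M} {h : X → ℝ} (hh : θ.IsPrimitive s h) (r : ℝ) :
    θ.IsPrimitive s fun x => h x - r := fun x₀ => by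
  filter_upwards [hh x₀] with x hx
  rw [hx, add_sub_right_comm]

theorem IsPrimitive.sub_eq [PreconnectedSpace X] {s : X → M} {h k : X → ℝ}
    (hh : θ.IsPrimitive s h) (hk : θ.IsPrimitive s k) (x y : X) : h y - h x = k y - k x := by
  have hconst : IsLocallyConstant fun x => h x - k x := by
    refine (IsLocallyConstant.iff_eventually_eq _).2 fun x₀ => ?_
    filter_upwards [hh x₀, hk x₀] with x h₁ h₂
    rw [h₁, h₂, add_sub_add_right_eq_sub]
  have := hconst.apply_eq_of_preconnectedSpace x y
  linarith

theorem IsPrimitive.continuous {s : X → M} {h : X → ℝ} (hh : θ.IsPrimitive s h)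
    (hs : Continuous s) (hθ : ∀ y, ContinuousAt (θ.prim y) y) : Continuous h := by
  refine continuous_iff_continuousAt.2 fun x₀ => ContinuousAt.congr ?_ (EventuallyEq.symm (hh x₀))
  exact continuousAt_const.add (ContinuousAt.comp (hθ (s x₀)) hs.continuousAt)

variable (θ)

/-- The space of germs of primitives of `θ`. A germ is determined by its base point and its value
there. -/
@[ext]
structure GermSpace (θ : LocalPrimitives M) where
  /-- The point at which the germ is taken. -/
  pt : M
  /-- The value of the primitive. -/
  val : ℝ

namespace GermSpace

variable {θ}

/-- The germ at `w` of the primitive with germ `e`; it is meaningful for `w` near `e.pt`. -/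
def extend (e : θ.GermSpace) (w : M) : θ.GermSpace := ⟨w, e.val + θ.prim e.pt w⟩

theorem extend_pt (e : θ.GermSpace) : e.extend e.pt = e := by
  rw [extend, prim_self, add_zero]

theorem eventually_extend_extend (e : θ.GermSpace) :
    ∀ᶠ w in 𝓝 e.pt, ∀ᶠ v in 𝓝 w, (e.extend w).extend v = e.extend v := by
  filter_upwards [θ.compat e.pt] with w hw
  filter_upwards [hw] with v hv
  simp only [extend, hv, add_assoc]

instance : TopologicalSpace θ.GermSpace :=
  TopologicalSpace.mkOfNhds fun e => (𝓝 e.pt).map e.extend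

theorem nhds_eq (e : θ.GermSpace) : 𝓝 e = (𝓝 e.pt).map e.extend := by
  refine TopologicalSpace.nhds_mkOfNhds _ _ (fun e s hs => ?_) fun e s hs => ?_
  · exact e.extend_pt ▸ (show ∀ᶠ w in 𝓝 e.pt, e.extend w ∈ s from hs).self_of_nhds
  · change ∀ᶠ w in 𝓝 e.pt, ∀ᶠ v in 𝓝 w, (e.extend w).extend v ∈ s
    have hs : ∀ᶠ w in 𝓝 e.pt, e.extend w ∈ s := hs
    filter_upwards [e.eventually_extend_extend, hs.eventually_nhds] with w h₁ h₂
    filter_upwards [h₁, h₂] with v h₃ h₄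
    rwa [h₃]

theorem map_pt_nhds (e : θ.GermSpace) : (𝓝 e).map pt = 𝓝 e.pt := by
  rw [nhds_eq, map_map]
  exact map_id

theorem continuous_pt : Continuous (pt (θ := θ)) :=
  continuous_iff_continuousAt.2 fun e => e.map_pt_nhds.le

theorem continuousAt_iff {g : X → θ.GermSpace} {x : X} :
    ContinuousAt g x ↔ ContinuousAt (fun y => (g y).pt) x ∧
      ∀ᶠ y in 𝓝 x, (g y).val = (g x).val + θ.prim (g x).pt (g y).pt := by
  constructor
  · intro hg
    refine ⟨continuous_pt.continuousAt.comp hg, ?_⟩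
    rw [ContinuousAt, nhds_eq] at hg
    exact hg.eventually (p := fun e => e.val = (g x).val + θ.prim (g x).pt e.pt)
      (eventually_map.2 (Eventually.of_forall fun _ => rfl))
  · rintro ⟨hpt, hval⟩
    rw [ContinuousAt, nhds_eq]
    refine (tendsto_map.comp hpt).congr' ?_
    filter_upwards [hval] with y hy
    exact GermSpace.ext rfl hy.symm

theorem continuous_iff {g : X → θ.GermSpace} :
    Continuous g ↔ Continuous (pt ∘ g) ∧ θ.IsPrimitive (pt ∘ g) (val ∘ g) := by
  simp only [continuous_iff_continuousAt, continuousAt_iff, forall_and, IsPrimitive,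
    Function.comp_def]

instance : AddAction ℝ θ.GermSpace where
  vadd r e := ⟨e.pt, r + e.val⟩
  zero_vadd e := GermSpace.ext rfl (zero_add e.val)
  add_vadd r r' e := GermSpace.ext rfl (add_assoc r r' e.val)

theorem isAddQuotientCoveringMap_pt : IsAddQuotientCoveringMap (pt (θ := θ)) ℝ where
  toIsQuotientMap := IsOpenMap.isQuotientMap (.of_nhds_le fun e => e.map_pt_nhds.ge) continuous_pt
    fun y => ⟨⟨y, 0⟩, rfl⟩
  continuous_const_vadd r := by
    refine continuous_iff.2 ⟨continuous_pt, fun e => ?_⟩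
    filter_upwards [(continuous_iff.1 continuous_id).2 e] with e' he'
    exact (congrArg (r + ·) he').trans (add_assoc _ _ _).symm
  apply_eq_iff_mem_orbit {e₁ e₂} :=
    ⟨fun h => ⟨e₁.val - e₂.val, GermSpace.ext h.symm (sub_add_cancel _ _)⟩,
      fun ⟨_, h⟩ => (congrArg pt h).symm⟩
  disjoint e := by
    refine ⟨range e.extend, nhds_eq e ▸ range_mem_map, fun r => ?_⟩
    rintro ⟨_, ⟨_, ⟨w, rfl⟩, rfl⟩, w', h⟩
    obtain rfl : w' = w := congrArg pt h
    exact right_eq_add.1 (congrArg val h)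

theorem isCoveringMap_pt : IsCoveringMap (pt (θ := θ)) :=
  isAddQuotientCoveringMap_pt.isCoveringMap

end GermSpace

/-- The monodromy of the germs is a homomorphism to `ℝ`, so it is trivial on commutators. -/
theorem exists_isPrimitive_of_range_le_commutator [PathConnectedSpace X]
    [LocallyPathConnectedSpace X] (s : C(X, M)) (x₀ : X)
    (hs : (FundamentalGroup.map s x₀).range ≤ commutator (FundamentalGroup M (s x₀))) :
    ∃ h, θ.IsPrimitive s h := by
  let e₀ : GermSpace.pt (θ := θ) ⁻¹' {s x₀} := ⟨⟨s x₀, 0⟩, rfl⟩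
  have hcov := GermSpace.isAddQuotientCoveringMap_pt (θ := θ)
  have hle : commutator (FundamentalGroup M (s x₀)) ≤ (FundamentalGroup.mapOfEq
      ⟨GermSpace.pt, GermSpace.continuous_pt⟩ (x := e₀.1) e₀.2).range := by
    rw [← hcov.ker_monodromyPerm e₀, ← hcov.toMultiplicative.ker_fundamentalGroupToMulOpposite e₀]
    exact Abelianization.commutator_subset_ker _
  obtain ⟨g, ⟨-, hg⟩, -⟩ :=
    GermSpace.isCoveringMap_pt.existsUnique_continuousMap_lifts_of_range_le e₀.2 (hs.trans hle)
  exact ⟨_, hg ▸ (GermSpace.continuous_iff.1 g.continuous).2⟩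

theorem exists_isPrimitive_of_convex {E : Type*} [AddCommGroup E] [Module ℝ E] [TopologicalSpace E]
    [IsTopologicalAddGroup E] [ContinuousSMul ℝ E] [LocallyConvexSpace ℝ E] {K : Set E}
    (hK : Convex ℝ K) (hne : K.Nonempty) (s : C(K, M)) : ∃ h, θ.IsPrimitive s h := by
  have : ContractibleSpace K := hK.contractibleSpace hne
  have : LocallyPathConnectedSpace K := hK.locallyPathConnectedSpace
  refine θ.exists_isPrimitive_of_range_le_commutator s ⟨_, hne.some_mem⟩ ?_
  rintro _ ⟨c, rfl⟩
  rw [Subsingleton.elim c 1, map_one]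
  exact one_mem _

theorem exists_isPrimitive_curve (γ : C(unitInterval, M)) : ∃ h, θ.IsPrimitive γ h :=
  θ.exists_isPrimitive_of_convex (convex_Icc 0 1) ⟨0, unitInterval.zero_mem⟩ γ

/-- The integral of `θ` along a curve. -/
def integral (γ : C(unitInterval, M)) : ℝ :=
  (θ.exists_isPrimitive_curve γ).choose 1 - (θ.exists_isPrimitive_curve γ).choose 0

variable {θ}

theorem IsPrimitive.integral_eq {γ : C(unitInterval, M)} {h : unitInterval → ℝ}
    (hh : θ.IsPrimitive γ h) : θ.integral γ = h 1 - h 0 :=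
  (θ.exists_isPrimitive_curve γ).choose_spec.sub_eq hh 0 1

theorem IsPrimitive.integral_comp {s : C(X, M)} {h : X → ℝ} (hh : θ.IsPrimitive s h)
    (γ : C(unitInterval, X)) : θ.integral (s.comp γ) = h (γ 1) - h (γ 0) :=
  IsPrimitive.integral_eq (γ := s.comp γ) (hh.comp γ.continuous)

end LocalPrimitives

/-! ### Periods on singular homology -/

section Cocycles

variable {X : SSet.{u}} {V : Type u} [AddCommGroup V]

/-- A `1`-cocycle on a simplicial set. -/
def IsOneCocycle (c : X _⦋1⦌ → V) : Prop :=
  ∀ τ : X _⦋2⦌, c (X.δ 0 τ) - c (X.δ 1 τ) + c (X.δ 2 τ) = 0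

/-- The homomorphism `ℤ → V` that sends `1` to a given element of `V`. -/
def coeffHom : V →+ (coeff.{u} ⟶ ModuleCat.of ℤ V) :=
  AddMonoidHom.mk' (fun v => ModuleCat.ofHom
    ((LinearMap.toSpanSingleton ℤ V v).comp ULift.moduleEquiv.toLinearMap)) fun v w => by
      ext n
      exact smul_add n.down v w

theorem coeffHom_apply_one (v : V) : (coeffHom v).hom (ULift.up 1) = v :=
  one_smul ℤ v

/-- The `1`-cochain with given values on the `1`-simplices. -/
def cochain (c : X _⦋1⦌ → V) : (X.chainComplex coeff.{u}).X 1 ⟶ ModuleCat.of ℤ V :=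
  Limits.Cofan.IsColimit.desc (X.isColimitChainComplexXCofan coeff.{u} 1) fun σ => coeffHom (c σ)

theorem ι_cochain (c : X _⦋1⦌ → V) (σ : X _⦋1⦌) :
    X.ιChainComplex (R := coeff.{u}) σ ≫ cochain c = coeffHom (c σ) :=
  Limits.Cofan.IsColimit.fac _ _ _

namespace IsOneCocycle

variable {c : X _⦋1⦌ → V}

theorem d_cochain (hc : IsOneCocycle c) :
    (X.chainComplex coeff.{u}).d 2 1 ≫ cochain c = 0 := by
  refine SSet.chainComplex_hom_ext fun τ => ?_
  rw [SSet.ιChainComplex_d_assoc, Fin.sum_univ_three, Limits.comp_zero,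
    ← map_zero coeffHom, ← hc τ, map_add, map_sub]
  simp [Preadditive.add_comp, ι_cochain, sub_eq_add_neg]

/-- The homomorphism `H₁(X) → V` given by a `1`-cocycle. -/
def homologyHom (hc : IsOneCocycle c) :
    (X.chainComplex coeff.{u}).homology 1 ⟶ ModuleCat.of ℤ V :=
  (X.chainComplex coeff).homologyι 1 ≫
    (X.chainComplex coeff).descOpcycles (cochain c) 2 (by simp) hc.d_cochain

theorem liftCycles_homologyHom (hc : IsOneCocycle c) (σ : X _⦋1⦌)
    (hσ : X.ιChainComplex (R := coeff) σ ≫ (X.chainComplex coeff).d 1 0 = 0) :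
    ((X.chainComplex coeff).liftCycles (X.ιChainComplex σ) 0 (by simp) hσ ≫
      (X.chainComplex coeff).homologyπ 1) ≫ hc.homologyHom = coeffHom (c σ) := by
  rw [homologyHom, Category.assoc, HomologicalComplex.homology_π_ι_assoc,
    HomologicalComplex.liftCycles_i_assoc, HomologicalComplex.p_descOpcycles, ι_cochain]

end IsOneCocycle

end Cocycles

variable {M : Type u} [TopologicalSpace M]

theorem H1map_loopClass (f : C(M, M)) {x : M} (γ : Path x x) :
    H1map f (loopClass γ) = loopClass (γ.map f.continuous) := by
  let C := (TopCat.toSSet.obj (TopCat.of M)).chainComplex coeff.{u}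
  let φ : C ⟶ C := SSet.chainComplexMap (TopCat.toSSet.map (TopCat.ofHom f)) coeff
  have hf : (TopCat.toSSet.map (TopCat.ofHom f)).app _ (pathSimplex γ) =
      pathSimplex (γ.map f.continuous) := rfl
  have hclass : (C.liftCycles _ 0 (by simp) (loop_cycle γ) ≫ C.homologyπ 1) ≫
      HomologicalComplex.homologyMap φ 1 =
      C.liftCycles _ 0 (by simp) (loop_cycle (γ.map f.continuous)) ≫ C.homologyπ 1 := by
    rw [Category.assoc, HomologicalComplex.homologyπ_naturality, ← Category.assoc]
    congr 1
    rw [← cancel_mono (C.iCycles 1), Category.assoc, HomologicalComplex.cyclesMap_i,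
      HomologicalComplex.liftCycles_i_assoc, HomologicalComplex.liftCycles_i,
      SSet.ι_chainComplexMap_f, hf]
  exact congrArg (fun ψ => ψ.hom (ULift.up 1)) hclass

namespace LocalPrimitives

variable (θ : LocalPrimitives M)

/-- The integral of `θ` over a singular `1`-simplex. -/
def simplexIntegral (σ : TopCat.toSSet.obj (TopCat.of M) _⦋1⦌) : ℝ :=
  θ.integral ((TopCat.toSSetObjEquiv _ _ σ : C(stdSimplex ℝ (Fin 2), M)).comp
    (stdSimplexHomeomorphUnitInterval.symm : C(unitInterval, stdSimplex ℝ (Fin 2))))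

theorem simplexIntegral_pathSimplex {x y : M} (γ : Path x y) :
    θ.simplexIntegral (pathSimplex γ) = θ.integral γ := by
  refine congrArg θ.integral (ContinuousMap.ext fun t => ?_)
  simp only [pathSimplex, TopCat.toSSetObj₁Equiv, Equiv.symm_trans, pathHom, Equiv.coe_trans,
    ContinuousMap.comp_apply]
  rfl

variable {θ} in
theorem IsPrimitive.simplexIntegral_eq {σ : TopCat.toSSet.obj (TopCat.of M) _⦋1⦌}
    {h : stdSimplex ℝ (Fin 2) → ℝ} (hh : θ.IsPrimitive (TopCat.toSSetObjEquiv _ _ σ) h) :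
    θ.simplexIntegral σ = h (stdSimplex.vertex 1) - h (stdSimplex.vertex 0) := by
  refine (IsPrimitive.integral_comp hh _).trans ?_
  congr 2 <;> exact (Homeomorph.symm_apply_eq _).2 (by simp)

theorem isOneCocycle_simplexIntegral :
    IsOneCocycle fun σ => ULift.up.{u} (θ.simplexIntegral σ) := by
  intro τ
  obtain ⟨k, hk⟩ := θ.exists_isPrimitive_of_convex (convex_stdSimplex ℝ (Fin 3))
    ⟨_, single_mem_stdSimplex ℝ 0⟩ (TopCat.toSSetObjEquiv _ _ τ)
  have hface (i : Fin 3) :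
      θ.simplexIntegral ((TopCat.toSSet.obj (TopCat.of M)).δ i τ) =
        k (stdSimplex.vertex (i.succAbove 1)) - k (stdSimplex.vertex (i.succAbove 0)) := by
    have hδ : ⇑(TopCat.toSSetObjEquiv _ _ ((TopCat.toSSet.obj (TopCat.of M)).δ i τ)) =
        TopCat.toSSetObjEquiv _ _ τ ∘ stdSimplex.map i.succAbove :=
      funext (TopCat.toSSetObjEquiv_δ_apply τ i)
    have hcomp := hk.comp (stdSimplex.continuous_map (S := ℝ) i.succAbove)
    rw [← hδ] at hcomp
    simpa only [Function.comp_apply, stdSimplex.map_vertex] using hcomp.simplexIntegral_eq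
  refine ULift.ext _ _ ?_
  change θ.simplexIntegral _ - θ.simplexIntegral _ + θ.simplexIntegral _ = 0
  rw [hface, hface, hface]
  simp [Fin.succAbove]

/-- The value of `θ` on homology classes, by integration over singular cycles. -/
def period : H1 M →ₗ[ℤ] ℝ :=
  ULift.moduleEquiv.toLinearMap.comp
    (θ.isOneCocycle_simplexIntegral.homologyHom.hom : H1 M →ₗ[ℤ] ULift.{u} ℝ)

theorem period_loopClass {x : M} (γ : Path x x) : θ.period (loopClass γ) = θ.integral γ := by
  have h := θ.isOneCocycle_simplexIntegral.liftCycles_homologyHom _ (loop_cycle γ)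
  have h₁ := congrArg (fun φ => φ.hom (ULift.up 1)) h
  rw [coeffHom_apply_one, simplexIntegral_pathSimplex] at h₁
  exact congrArg ULift.down h₁

end LocalPrimitives

/-! ### Local primitives of smooth closed one-forms -/

section Forms

variable {m : ℕ} {M : Type u} [TopologicalSpace M] [ChartedSpace (EuclideanSpace ℝ (Fin m)) M]

/-- `g` is a `C¹` primitive of the one-form `η` near the point `y`. -/
def OneForm.HasPrimitiveNear (η : OneForm m M) (g : M → ℝ) (y : M) : Prop :=
  ∀ᶠ w in 𝓝 y, HasMFDerivAt (𝓡 m) 𝓘(ℝ, ℝ) g w (η w) ∧ ContMDiffAt (𝓡 m) 𝓘(ℝ, ℝ) 1 g w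

theorem OneForm.HasPrimitiveNear.sub_const {η : OneForm m M} {g : M → ℝ} {y : M}
    (hg : η.HasPrimitiveNear g y) (r : ℝ) : η.HasPrimitiveNear (fun w => g w - r) y := by
  filter_upwards [hg] with w hw
  exact ⟨(hw.1.sub (hasMFDerivAt_const r w)).congr_mfderiv (sub_zero (η w)),
    hw.2.sub contMDiffAt_const⟩

namespace LocalPrimitives

/-- The germs of `θ` are primitives of the one-form `η`. -/
def Represents (θ : LocalPrimitives M) (η : OneForm m M) : Prop :=
  ∀ y, η.HasPrimitiveNear (θ.prim y) y

namespace Represents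

variable {θ : LocalPrimitives M} {η : OneForm m M}

theorem hasMFDerivAt (hθ : θ.Represents η) (y : M) :
    HasMFDerivAt (𝓡 m) 𝓘(ℝ, ℝ) (θ.prim y) y (η y) :=
  (hθ y).self_of_nhds.1

theorem contMDiffAt (hθ : θ.Represents η) (y : M) : ContMDiffAt (𝓡 m) 𝓘(ℝ, ℝ) 1 (θ.prim y) y :=
  (hθ y).self_of_nhds.2

variable {s : ℝ → M} {h : ℝ → ℝ} {S : Set ℝ} {t : ℝ}

theorem contDiffWithinAt (hθ : θ.Represents η) (hh : θ.IsPrimitive s h)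
    (hs : ContMDiffWithinAt 𝓘(ℝ, ℝ) (𝓡 m) 1 s S t) :
    ContDiffWithinAt ℝ 1 h S t :=
  (contDiffWithinAt_const.add
    ((hθ.contMDiffAt (s t)).comp_contMDiffWithinAt t hs).contDiffWithinAt).congr_of_eventuallyEq
    ((hh t).filter_mono nhdsWithin_le_nhds) (hh t).self_of_nhds

theorem hasDerivWithinAt (hθ : θ.Represents η) (hh : θ.IsPrimitive s h)
    (hs : MDifferentiableWithinAt 𝓘(ℝ, ℝ) (𝓡 m) s S t) :
    HasDerivWithinAt h (η (s t) (mfderivWithin 𝓘(ℝ, ℝ) (𝓡 m) s S t (1 : ℝ))) S t :=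
  ((((hθ.hasMFDerivAt (s t)).comp_hasMFDerivWithinAt t
    hs.hasMFDerivWithinAt).hasFDerivWithinAt.const_add (h t)).congr_of_eventuallyEq
    ((hh t).filter_mono nhdsWithin_le_nhds) (hh t).self_of_nhds).hasDerivWithinAt

theorem integral_eq (hθ : θ.Represents η) {x y : M} {γ : Path x y} (hγ : IsSmoothPath m γ) :
    η.integral γ = θ.integral γ := by
  obtain ⟨h, hh⟩ := θ.exists_isPrimitive_curve γ
  have hext : θ.IsPrimitive γ.extend (h ∘ projIcc 0 1 zero_le_one) := hh.comp continuous_projIcc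
  have hsmooth : ContDiffOn ℝ 1 (h ∘ projIcc 0 1 zero_le_one) (Icc 0 1) := fun t ht =>
    hθ.contDiffWithinAt hext ((hγ t ht).of_le (by simp))
  calc η.integral γ
      = ∫ t in (0 : ℝ)..1, derivWithin (h ∘ projIcc 0 1 zero_le_one) (Icc 0 1) t := by
        refine intervalIntegral.integral_congr fun t ht => ?_
        rw [uIcc_of_le zero_le_one] at ht
        exact ((hθ.hasDerivWithinAt hext ((hγ t ht).mdifferentiableWithinAt
          (by simp))).derivWithin (uniqueDiffOn_Icc zero_lt_one t ht)).symm
    _ = θ.integral γ := by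
        rw [intervalIntegral.integral_derivWithin_Icc_of_contDiffOn_Icc hsmooth zero_le_one,
          hh.integral_eq]
        simp

end Represents

end LocalPrimitives

theorem OneForm.IsSmoothClosed.exists_inChart_primitive {η : OneForm m M}
    (hη : η.IsSmoothClosed) (y : M) :
    ∃ G : EuclideanSpace ℝ (Fin m) → ℝ, ∀ᶠ e in 𝓝 (extChartAt (𝓡 m) y y),
      HasFDerivAt G (η.inChart y e) e ∧ ContDiffAt ℝ 1 G e := by
  obtain ⟨r, hr, hB⟩ := Metric.isOpen_iff.1 (isOpen_extChartAt_target (I := 𝓡 m) y) _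
    (mem_extChartAt_target y)
  have hsmooth := (hη.smooth y).mono hB
  obtain ⟨G, hG⟩ := (convex_ball _ r).exists_forall_hasFDerivAt_of_fderiv_symmetric
    Metric.isOpen_ball (hsmooth.differentiableOn (by simp))
    fun e he v w => hη.closed y e (hB he) v w
  have hG₁ : ContDiffOn ℝ 1 G (Metric.ball (extChartAt (𝓡 m) y y) r) := by
    rw [← zero_add (1 : ℕ∞ω), contDiffOn_succ_iff_fderiv_of_isOpen Metric.isOpen_ball]
    exact ⟨fun e he => (hG e he).differentiableAt.differentiableWithinAt, by simp,
      (hsmooth.of_le (by simp)).congr fun e he => (hG e he).fderiv⟩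
  refine ⟨G, ?_⟩
  filter_upwards [Metric.ball_mem_nhds _ hr] with e he
  exact ⟨hG e he, hG₁.contDiffAt (Metric.isOpen_ball.mem_nhds he)⟩

theorem tendsto_extChartAt_symm (y : M) :
    Tendsto (extChartAt (𝓡 m) y).symm (𝓝 (extChartAt (𝓡 m) y y)) (𝓝 y) := by
  simpa only [ContinuousAt, extChartAt_to_inv] using continuousAt_extChartAt_symm (I := 𝓡 m) y

variable [IsManifold (𝓡 m) ∞ M]

theorem OneForm.inChart_comp_mfderiv (η : OneForm m M) {x w : M}
    (hw : w ∈ (extChartAt (𝓡 m) x).source) :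
    (η.inChart x (extChartAt (𝓡 m) x w)).comp (mfderiv (𝓡 m) (𝓡 m) (extChartAt (𝓡 m) x) w) =
      η w := by
  have : IsManifold (𝓡 m) 1 M := IsManifold.of_le (n := ∞) (by simp)
  have hchart := mfderivWithin_extChartAt_symm_comp_mfderiv_extChartAt' (I := 𝓡 m) hw
  rw [ModelWithCorners.range_eq_univ, mfderivWithin_univ] at hchart
  have hη : ∀ w' : M, w' = w → ∀ v : EuclideanSpace ℝ (Fin m), η w' v = η w v := by
    rintro w' rfl v; rfl
  ext v
  refine (hη _ ((extChartAt (𝓡 m) x).left_inv hw) _).trans ?_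
  exact congrArg (η w) (congrArg (fun L => L v) hchart)

theorem OneForm.IsSmoothClosed.exists_hasPrimitiveNear {η : OneForm m M} (hη : η.IsSmoothClosed)
    (y : M) : ∃ g : M → ℝ, η.HasPrimitiveNear g y := by
  have : IsManifold (𝓡 m) 1 M := IsManifold.of_le (n := ∞) (by simp)
  obtain ⟨G, hG⟩ := hη.exists_inChart_primitive y
  refine ⟨G ∘ extChartAt (𝓡 m) y, ?_⟩
  filter_upwards [(continuousAt_extChartAt (I := 𝓡 m) y).eventually hG,
    extChartAt_source_mem_nhds (I := 𝓡 m) y] with w hw hws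
  have hws' : w ∈ (chartAt (EuclideanSpace ℝ (Fin m)) y).source := by
    rwa [← extChartAt_source (I := 𝓡 m)]
  exact ⟨(hw.1.hasMFDerivAt.comp w (mdifferentiableAt_extChartAt hws').hasMFDerivAt).congr_mfderiv
      (η.inChart_comp_mfderiv hws), hw.2.contMDiffAt.comp w (contMDiffAt_extChartAt' hws')⟩

theorem eventually_eq_of_hasMFDerivAt_zero {d : M → ℝ} {y : M}
    (hd : ∀ᶠ w in 𝓝 y, HasMFDerivAt (𝓡 m) 𝓘(ℝ, ℝ) d w 0) : ∀ᶠ w in 𝓝 y, d w = d y := by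
  have : IsManifold (𝓡 m) 1 M := IsManifold.of_le (n := ∞) (by simp)
  set φ := extChartAt (𝓡 m) y
  have hderiv : ∀ᶠ e in 𝓝 (φ y), HasFDerivAt (d ∘ φ.symm) (0 : _ →L[ℝ] ℝ) e := by
    filter_upwards [(tendsto_extChartAt_symm y).eventually hd,
      extChartAt_target_mem_nhds (I := 𝓡 m) y] with e he het
    have hφ := mdifferentiableWithinAt_extChartAt_symm (I := 𝓡 m) het
    rw [ModelWithCorners.range_eq_univ, mdifferentiableWithinAt_univ] at hφ
    exact ((he.comp e hφ.hasMFDerivAt).congr_mfderiv (ContinuousLinearMap.zero_comp _)).hasFDerivAt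
  obtain ⟨r, hr, hB⟩ := Metric.eventually_nhds_iff_ball.1 hderiv
  filter_upwards [(continuousAt_extChartAt (I := 𝓡 m) y).eventually (Metric.ball_mem_nhds _ hr),
    extChartAt_source_mem_nhds (I := 𝓡 m) y] with w hw hws
  have hconst := Metric.isOpen_ball.is_const_of_fderiv_eq_zero (𝕜 := ℝ)
    (convex_ball (φ y) r).isPreconnected
    (fun e he => (hB e he).differentiableAt.differentiableWithinAt)
    (fun e he => (hB e he).fderiv) hw (Metric.mem_ball_self hr)
  simp only [Function.comp_apply] at hconst
  rwa [φ.left_inv hws, φ.left_inv (mem_extChartAt_source y)] at hconst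

theorem OneForm.HasPrimitiveNear.eventually_sub_eq {η : OneForm m M} {g g' : M → ℝ} {y : M}
    (hg : η.HasPrimitiveNear g y) (hg' : η.HasPrimitiveNear g' y) :
    ∀ᶠ w in 𝓝 y, g w - g' w = g y - g' y := by
  refine eventually_eq_of_hasMFDerivAt_zero (m := m) (d := g - g') ?_
  filter_upwards [hg, hg'] with w hw hw'
  exact (hw.1.sub hw'.1).congr_mfderiv (sub_self (η w))

theorem OneForm.IsSmoothClosed.exists_represents {η : OneForm m M} (hη : η.IsSmoothClosed) :
    ∃ θ : LocalPrimitives M, θ.Represents η := by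
  choose g hg using hη.exists_hasPrimitiveNear
  refine ⟨⟨fun y w => g y w - g y y, fun y => ?_⟩, fun y => (hg y).sub_const _⟩
  filter_upwards [(hg y).eventually_nhds] with y' hy'
  filter_upwards [OneForm.HasPrimitiveNear.eventually_sub_eq hy' (hg y')] with w hw
  linarith

end Forms

/-! ### Smooth paths in a covering space -/

section SmoothPaths

variable {m : ℕ} {M : Type u} [TopologicalSpace M] [ChartedSpace (EuclideanSpace ℝ (Fin m)) M]
  {M' : Type v} [TopologicalSpace M']

/-- `c` is a curve from `x` to `y`, smooth after projection by `p` and constant outside the unit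
interval. The constant ends make such curves composable without loss of smoothness. -/
structure IsCollaredCurve (m : ℕ) {M : Type u} [TopologicalSpace M]
    [ChartedSpace (EuclideanSpace ℝ (Fin m)) M] {M' : Type v} [TopologicalSpace M'] (p : M' → M)
    (x y : M') (c : ℝ → M') : Prop where
  continuous : Continuous c
  smooth : ContMDiff 𝓘(ℝ, ℝ) (𝓡 m) ∞ (p ∘ c)
  eq_left : ∀ t ≤ 0, c t = x
  eq_right : ∀ t, 1 ≤ t → c t = y

namespace IsCollaredCurve

variable {p : M' → M} {x y z : M'} {c c' : ℝ → M'}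

theorem symm (h : IsCollaredCurve m p x y c) : IsCollaredCurve m p y x fun t => c (1 - t) where
  continuous := h.continuous.comp (by fun_prop)
  smooth := h.smooth.comp (g := p ∘ c) (contDiff_const.sub contDiff_id).contMDiff
  eq_left t ht := h.eq_right _ (by linarith)
  eq_right t ht := h.eq_left _ (by linarith)

theorem trans (h : IsCollaredCurve m p x y c) (h' : IsCollaredCurve m p y z c') :
    IsCollaredCurve m p x z fun t => if t < 1 / 2 then c (3 * t) else c' (3 * t - 2) := by
  set d : ℝ → M' := fun t => if t < 1 / 2 then c (3 * t) else c' (3 * t - 2)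
  have eq_fst : ∀ t < 1 / 2, d t = c (3 * t) := fun t ht => if_pos ht
  have eq_snd : ∀ t > 1 / 3, d t = c' (3 * t - 2) := fun t ht => by
    by_cases ht' : t < 1 / 2
    · rw [eq_fst t ht', h.eq_right _ (by linarith), h'.eq_left _ (by linarith)]
    · exact if_neg ht'
  have local_eq : ∀ t, d =ᶠ[𝓝 t] (fun s => c (3 * s)) ∨ d =ᶠ[𝓝 t] fun s => c' (3 * s - 2) := by
    intro t
    rcases lt_or_ge t (1 / 2) with ht | ht
    · exact .inl ((gt_mem_nhds ht).mono eq_fst)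
    · exact .inr ((lt_mem_nhds (by linarith)).mono eq_snd)
  refine ⟨continuous_iff_continuousAt.2 fun t => ?_, fun t => ?_, fun t ht => ?_, fun t ht => ?_⟩
  · rcases local_eq t with ht | ht
    · exact (h.continuous.comp (by fun_prop)).continuousAt.congr ht.symm
    · exact (h'.continuous.comp (by fun_prop)).continuousAt.congr ht.symm
  · rcases local_eq t with ht | ht
    · exact (h.smooth.comp (g := p ∘ c)
        (contDiff_const.mul contDiff_id).contMDiff t).congr_of_eventuallyEq (ht.fun_comp p)
    · exact (h'.smooth.comp (g := p ∘ c') ((contDiff_const.mul contDiff_id).sub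
        contDiff_const).contMDiff t).congr_of_eventuallyEq (ht.fun_comp p)
  · rw [eq_fst t (by linarith), h.eq_left _ (by linarith)]
  · rw [eq_snd t (by linarith), h'.eq_right _ (by linarith)]

/-- The restriction of a collared curve to the unit interval. -/
def path (h : IsCollaredCurve m p x y c) : Path x y where
  toFun t := c t
  continuous_toFun := h.continuous.comp continuous_subtype_val
  source' := h.eq_left _ le_rfl
  target' := h.eq_right _ le_rfl

theorem isSmoothPath {p : C(M', M)} (h : IsCollaredCurve m p x y c) :
    IsSmoothPath m (h.path.map p.continuous) :=
  h.smooth.contMDiffOn.congr fun _ ht => Path.extend_apply _ ht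

end IsCollaredCurve

variable [IsManifold (𝓡 m) ∞ M]

theorem eventually_exists_isCollaredCurve {p : M' → M} (hp : IsLocalHomeomorph p) (x : M') :
    ∀ᶠ x' in 𝓝 x, ∃ c, IsCollaredCurve m p x x' c := by
  obtain ⟨e, hxe, rfl⟩ := hp x
  set φ := extChartAt (𝓡 m) (e x)
  obtain ⟨r, hr, hB⟩ := Metric.eventually_nhds_iff_ball.1 (Eventually.and
    (extChartAt_target_mem_nhds (I := 𝓡 m) (e x))
    ((tendsto_extChartAt_symm (m := m) (e x)).eventually
      (e.open_target.mem_nhds (e.map_source hxe))))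
  have hex : Tendsto e (𝓝 x) (𝓝 (e x)) := e.continuousAt hxe
  filter_upwards [e.open_source.mem_nhds hxe,
    hex.eventually (extChartAt_source_mem_nhds (I := 𝓡 m) (e x)),
    hex.eventually ((continuousAt_extChartAt (I := 𝓡 m) (e x)).eventually
      (Metric.ball_mem_nhds _ hr))] with x' hx' hφx' hball
  let l : ℝ → EuclideanSpace ℝ (Fin m) := fun t =>
    φ (e x) + Real.smoothTransition t • (φ (e x') - φ (e x))
  have hl_mem : ∀ t, l t ∈ Metric.ball (φ (e x)) r := fun t =>
    (convex_ball _ _).add_smul_sub_mem (Metric.mem_ball_self hr) hball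
      ⟨Real.smoothTransition.nonneg t, Real.smoothTransition.le_one t⟩
  have hl_smooth : ContDiff ℝ ∞ l :=
    contDiff_const.add (Real.smoothTransition.contDiff.smul contDiff_const)
  have hφl : ContMDiff 𝓘(ℝ, ℝ) (𝓡 m) ∞ fun t => φ.symm (l t) :=
    (contMDiffOn_extChartAt_symm (I := 𝓡 m) (n := ∞) (e x)).comp_contMDiff hl_smooth.contMDiff
      fun t => (hB _ (hl_mem t)).1
  refine ⟨fun t => e.symm (φ.symm (l t)),
    e.continuousOn_symm.comp_continuous hφl.continuous fun t => (hB _ (hl_mem t)).2,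
    hφl.congr fun t => e.right_inv (hB _ (hl_mem t)).2, fun t ht => ?_, fun t ht => ?_⟩
  · have : l t = φ (e x) := by simp [l, Real.smoothTransition.zero_of_nonpos ht]
    rw [this, φ.left_inv (mem_extChartAt_source _), e.left_inv hxe]
  · have : l t = φ (e x') := by simp [l, Real.smoothTransition.one_of_one_le ht]
    rw [this, φ.left_inv hφx', e.left_inv hx']

theorem exists_isSmoothPath [PreconnectedSpace M'] {p : C(M', M)} (hp : IsLocalHomeomorph p)
    (x y : M') : ∃ γ : Path x y, IsSmoothPath m (γ.map p.continuous) := by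
  obtain ⟨c, hc⟩ : ∃ c, IsCollaredCurve m p x y c := by
    refine PreconnectedSpace.induction₂' (fun x y => ∃ c, IsCollaredCurve m p x y c)
      (fun x => ?_) ⟨fun _ _ _ ⟨_, h⟩ ⟨_, h'⟩ => ⟨_, h.trans h'⟩⟩ x y
    filter_upwards [eventually_exists_isCollaredCurve (m := m) hp x] with y ⟨c, hc⟩
    exact ⟨⟨c, hc⟩, _, hc.symm⟩
  exact ⟨hc.path, hc.isSmoothPath⟩

end SmoothPaths

/-! ### The map to `ℝ^b` as a primitive -/

theorem locallyPathConnectedSpace_of_isLocalHomeomorph {X Y : Type*} [TopologicalSpace X]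
    [TopologicalSpace Y] [LocallyPathConnectedSpace Y] {p : X → Y} (hp : IsLocalHomeomorph p) :
    LocallyPathConnectedSpace X := by
  choose e he using hp
  let _ : ChartedSpace Y X := ⟨range e, e, fun x => (he x).1, fun x => ⟨x, rfl⟩⟩
  exact ChartedSpace.locallyPathConnectedSpace Y X

section Albanese

variable {b m : ℕ} {M : Type u} [TopologicalSpace M] [ChartedSpace (EuclideanSpace ℝ (Fin m)) M]
  [IsManifold (𝓡 m) ∞ M] {M' : Type v} [TopologicalSpace M'] [PathConnectedSpace M'] {p : C(M', M)}
  {η : Fin b → OneForm m M} {θ : Fin b → LocalPrimitives M}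

theorem isPrimitive_albanese (hp : IsLocalHomeomorph p) {z : M'}
    (hz : (FundamentalGroup.map p z).range ≤ commutator (FundamentalGroup M (p z)))
    (hθ : ∀ i, (θ i).Represents (η i)) (i : Fin b) :
    (θ i).IsPrimitive p fun x => albanese p η z x i := by
  have : LocallyPathConnectedSpace M :=
    ChartedSpace.locallyPathConnectedSpace (EuclideanSpace ℝ (Fin m)) M
  have : LocallyPathConnectedSpace M' :=
    locallyPathConnectedSpace_of_isLocalHomeomorph hp
  obtain ⟨h, hh⟩ := (θ i).exists_isPrimitive_of_range_le_commutator p z hz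
  suffices ∀ x, albanese p η z x i = h x - h z by
    simpa only [this] using hh.sub_const (h z)
  intro x
  have hx := exists_isSmoothPath (m := m) hp z x
  rw [albanese, dif_pos hx, (hθ i).integral_eq hx.choose_spec]
  exact (hh.integral_comp hx.choose.toContinuousMap).trans (by simp)

theorem continuous_albanese (hp : IsLocalHomeomorph p) {z : M'}
    (hz : (FundamentalGroup.map p z).range ≤ commutator (FundamentalGroup M (p z)))
    (hθ : ∀ i, (θ i).Represents (η i)) : Continuous (albanese p η z) :=
  continuous_pi fun i => (isPrimitive_albanese hp hz hθ i).continuous p.continuous fun y =>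
    ((hθ i).hasMFDerivAt y).continuousAt

end Albanese

/-! ### Spectral radius and adapted norms -/

section SpectralRadius

variable {R : Type*} [NormedRing R] [NormedAlgebra ℂ R] [CompleteSpace R]

theorem spectralRadius_inv_lt_one_of_forall_one_lt (a : Rˣ)
    (ha : ∀ μ ∈ spectrum ℂ (a : R), 1 < ‖μ‖) : spectralRadius ℂ (↑a⁻¹ : R) < 1 := by
  rcases subsingleton_or_nontrivial R
  · simp
  refine spectrum.spectralRadius_lt_of_forall_lt _ (r := 1) fun μ hμ => ?_
  rw [← spectrum.map_inv] at hμ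
  have := inv_lt_one_of_one_lt₀ (ha _ hμ)
  rwa [norm_inv, inv_inv] at this

theorem exists_nnnorm_pow_le_of_spectralRadius_lt {a : R} {r : ℝ≥0}
    (ha : spectralRadius ℂ a < r) : ∃ n > 0, ‖a ^ n‖₊ ≤ r ^ n := by
  obtain ⟨n, hlt, hn⟩ :=
    (((spectrum.pow_nnnorm_pow_one_div_tendsto_nhds_spectralRadius a).eventually
      (gt_mem_nhds ha)).and (eventually_gt_atTop 0)).exists
  rw [one_div, ENNReal.rpow_inv_lt_iff (Nat.cast_pos.2 hn), ENNReal.rpow_natCast] at hlt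
  exact ⟨n, hn, mod_cast hlt.le⟩

end SpectralRadius

theorem exists_seminorm_apply_le {𝕜 E : Type*} [NormedField 𝕜] [AddCommGroup E] [Module 𝕜 E]
    (q : Seminorm 𝕜 E) (T : E →ₗ[𝕜] E) {r : ℝ≥0} (hr : r ≠ 0) {n : ℕ} (hn : 0 < n)
    (hT : ∀ v, q ((T ^ n) v) ≤ r ^ n * q v) :
    ∃ N : Seminorm 𝕜 E, q ≤ N ∧ ∀ v, N (T v) ≤ r * N v := by
  let g : ℕ → Seminorm 𝕜 E := fun i => (r⁻¹ ^ i : ℝ≥0) • q.comp (T ^ i)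
  have hg : ∀ i v, g i v = (r : ℝ)⁻¹ ^ i * q ((T ^ i) v) := fun i v => by
    simp [g, NNReal.smul_def]
  have hN : ∀ v, (∑ i ∈ Finset.range n, g i) v = ∑ i ∈ Finset.range n, g i v := fun v => by
    simp
  have hr' : (r : ℝ) ≠ 0 := NNReal.coe_ne_zero.2 hr
  have hg_apply : ∀ i v, g i (T v) = r * g (i + 1) v := fun i v => by
    rw [hg, hg, pow_succ' _ i, mul_assoc, mul_inv_cancel_left₀ hr', pow_succ T,
      Module.End.mul_apply]
  have hg_zero : ∀ v, g 0 v = q v := fun v => by simp [hg]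
  have hg_le : ∀ v, g n v ≤ g 0 v := fun v => by
    rw [hg, hg_zero, inv_pow, inv_mul_le_iff₀ (by positivity)]
    exact hT v
  refine ⟨∑ i ∈ Finset.range n, g i, fun v => ?_, fun v => ?_⟩
  · rw [hN, ← hg_zero]
    exact Finset.single_le_sum (f := fun i => g i v) (fun i _ => apply_nonneg _ _)
      (Finset.mem_range.2 hn)
  · rw [hN, hN, Finset.sum_congr rfl fun i _ => hg_apply i v, ← Finset.mul_sum]
    have := Finset.sum_range_succ' (fun i => g i v) n
    rw [Finset.sum_range_succ] at this
    gcongr r * ?_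
    linarith [hg_le v]

section AdaptedNorms

attribute [local instance] Matrix.linftyOpNormedRing Matrix.linftyOpNormedAlgebra

variable {ι : Type*} [Fintype ι] [DecidableEq ι]

theorem exists_seminorm_mulVec_le {C : Matrix ι ι ℂ} {r : ℝ≥0}
    (hC : spectralRadius ℂ C < r) :
    ∃ N : Seminorm ℂ (ι → ℂ), (∀ v, ‖v‖ ≤ N v) ∧ ∀ v, N (C *ᵥ v) ≤ r * N v := by
  obtain ⟨n, hn, hle⟩ := exists_nnnorm_pow_le_of_spectralRadius_lt hC
  refine exists_seminorm_apply_le (normSeminorm ℂ (ι → ℂ)) (Matrix.toLin' C)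
    (ENNReal.coe_ne_zero.1 (bot_le.trans_lt hC).ne') hn fun v => ?_
  rw [← Matrix.toLin'_pow, Matrix.toLin'_apply, coe_normSeminorm]
  exact (Matrix.linfty_opNorm_mulVec _ _).trans (by gcongr; exact mod_cast hle)

theorem isUnit_map_intCast (K : Type*) [Field K] [CharZero K] {A : Matrix ι ι ℤ} (hA : A.det ≠ 0) :
    IsUnit (A.map (Int.cast : ℤ → K)) := by
  rw [Matrix.isUnit_iff_isUnit_det, ← Int.cast_det, isUnit_iff_ne_zero]
  exact Int.cast_ne_zero.2 hA

theorem ofReal_comp_inv_mulVec {A : Matrix ι ι ℤ} (hA : A.det ≠ 0) (v : ι → ℝ) :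
    Complex.ofReal ∘ ((A.map (Int.cast : ℤ → ℝ))⁻¹ *ᵥ v) =
      (A.map (Int.cast : ℤ → ℂ))⁻¹ *ᵥ (Complex.ofReal ∘ v) := by
  have hℝ := (Matrix.isUnit_iff_isUnit_det _).1 (isUnit_map_intCast ℝ hA)
  have hℂ := (Matrix.isUnit_iff_isUnit_det _).1 (isUnit_map_intCast ℂ hA)
  have hmap : ∀ w : ι → ℝ, Complex.ofReal ∘ (A.map (Int.cast : ℤ → ℝ) *ᵥ w) =
      A.map (Int.cast : ℤ → ℂ) *ᵥ (Complex.ofReal ∘ w) := fun w => by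
    ext i
    simp [Matrix.mulVec, dotProduct]
  have := hmap ((A.map (Int.cast : ℤ → ℝ))⁻¹ *ᵥ v)
  rw [Matrix.mulVec_mulVec, Matrix.mul_nonsing_inv _ hℝ, Matrix.one_mulVec] at this
  rw [this, Matrix.mulVec_mulVec, Matrix.nonsing_inv_mul _ hℂ, Matrix.one_mulVec]

variable {b : ℕ} {A : Matrix (Fin b) (Fin b) ℤ} {lam : ℝ}

theorem IsExpanding.one_lt_norm_of_mem_spectrum (hA : IsExpanding A) {μ : ℂ}
    (hμ : μ ∈ spectrum ℂ (A.map (Int.cast : ℤ → ℂ))) : 1 < ‖μ‖ :=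
  hA μ (Module.End.hasEigenvalue_iff_mem_spectrum.2 (by rwa [Matrix.spectrum_toLin']))

theorem IsExpanding.isUnit_map (hA : IsExpanding A) : IsUnit (A.map (Int.cast : ℤ → ℂ)) := by
  refine spectrum.zero_notMem_iff ℂ |>.1 fun h => ?_
  have := hA.one_lt_norm_of_mem_spectrum h
  rw [norm_zero] at this
  exact zero_le_one.not_gt this

theorem IsExpanding.det_ne_zero (hA : IsExpanding A) : A.det ≠ 0 := by
  have := (Matrix.isUnit_iff_isUnit_det _).1 hA.isUnit_map
  rwa [← Int.cast_det, isUnit_iff_ne_zero, Int.cast_ne_zero] at this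

theorem IsExpanding.exists_isExpansionConstant (hA : IsExpanding A) :
    ∃ lam, IsExpansionConstant A lam := by
  obtain ⟨a, ha⟩ := hA.isUnit_map
  have hρ := spectralRadius_inv_lt_one_of_forall_one_lt a fun μ hμ =>
    hA.one_lt_norm_of_mem_spectrum (ha ▸ hμ)
  rw [Matrix.coe_units_inv, ha] at hρ
  obtain ⟨r, hr, hr₁⟩ := ENNReal.lt_iff_exists_nnreal_btwn.1 hρ
  have hr₀ : 0 < r := ENNReal.coe_pos.1 (bot_le.trans_lt hr)
  refine ⟨1 / r, one_lt_one_div hr₀ (mod_cast hr₁), ?_⟩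
  rwa [one_div_one_div, ENNReal.ofReal_coe_nnreal]

theorem IsExpansionConstant.exists_isAdaptedNorm (hA : A.det ≠ 0)
    (hlam : IsExpansionConstant A lam) : ∃ N, IsAdaptedNorm A lam N := by
  obtain ⟨r, hr, hr_lt⟩ := ENNReal.lt_iff_exists_nnreal_btwn.1 hlam.2
  obtain ⟨N, hN, hN_le⟩ := exists_seminorm_mulVec_le hr
  refine ⟨(N.restrictScalars ℝ).comp (Complex.ofRealCLM.toLinearMap.compLeft (Fin b)),
    fun v hv => ?_, r, ?_, fun v => ?_⟩
  · have : Complex.ofReal ∘ v = 0 := norm_le_zero_iff.1 ((hN _).trans hv.le)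
    exact funext fun i => Complex.ofReal_eq_zero.1 (congrFun this i)
  · rw [← ENNReal.ofReal_coe_nnreal] at hr_lt
    exact (ENNReal.ofReal_lt_ofReal_iff_of_nonneg r.2).1 hr_lt
  · exact (congrArg N (ofReal_comp_inv_mulVec hA v)).trans_le (hN_le _)

end AdaptedNorms

/-! ### Shadowing of pseudo-orbits of an expanding automorphism -/

section Shadowing

section NormedGroup

theorem pow_mul_norm_le_norm_iterate {E : Type*} [Norm E] {T : E → E} {lam : ℝ} (hlam : 0 ≤ lam)
    (hT : ∀ v, lam * ‖v‖ ≤ ‖T v‖) (n : ℕ) (v : E) : lam ^ n * ‖v‖ ≤ ‖T^[n] v‖ := by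
  induction n with
  | zero => simp
  | succ n ih =>
    rw [Function.iterate_succ_apply', pow_succ', mul_assoc]
    exact (mul_le_mul_of_nonneg_left ih hlam).trans (hT _)

variable {E : Type*} [NormedAddCommGroup E] {lam c : ℝ}

theorem eq_of_forall_norm_iterate_sub_le {G : Type*} [FunLike G E E] [AddMonoidHomClass G E E]
    {T : G} (hlam : 1 < lam) (hT : ∀ v, lam * ‖v‖ ≤ ‖T v‖) {v w : E}
    (h : ∀ n, ‖T^[n] v - T^[n] w‖ ≤ c) : v = w := by
  by_contra hne
  have hpos : 0 < ‖v - w‖ := norm_sub_pos_iff.2 hne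
  obtain ⟨n, hn⟩ := pow_unbounded_of_one_lt (c / ‖v - w‖) hlam
  rw [div_lt_iff₀ hpos] at hn
  refine (hn.trans_le ?_).not_ge (h n)
  rw [← iterate_map_sub]
  exact pow_mul_norm_le_norm_iterate (zero_le_one.trans hlam.le) hT n _

variable {T : E ≃+ E}

theorem norm_iterate_symm_le (hlam : 0 < lam) (hT : ∀ v, lam * ‖v‖ ≤ ‖T v‖) (n : ℕ) (v : E) :
    ‖T.symm^[n] v‖ ≤ ‖v‖ / lam ^ n := by
  rw [le_div_iff₀' (by positivity)]
  refine (pow_mul_norm_le_norm_iterate hlam.le hT n _).trans_eq ?_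
  rw [Function.LeftInverse.iterate T.apply_symm_apply n]

variable [CompleteSpace E]

/-- The limit is the sum of the geometrically convergent series
`u 0 + ∑ T⁻⁽ⁿ⁺¹⁾ (u (n + 1) - T (u n))`, written as the limit of its partial sums `T⁻ⁿ (u n)`. -/
theorem exists_tendsto_iterate_symm (hlam : 1 < lam) (hT : ∀ v, lam * ‖v‖ ≤ ‖T v‖) {u : ℕ → E}
    (hu : ∀ n, ‖u (n + 1) - T (u n)‖ ≤ c) :
    ∃ y, Tendsto (fun n => T.symm^[n] (u n)) atTop (𝓝 y) ∧ ‖u 0 - y‖ ≤ c / (lam - 1) := by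
  have hlam₀ : 0 < lam := one_pos.trans hlam
  have hdist : ∀ n, dist (T.symm^[n] (u n)) (T.symm^[n + 1] (u (n + 1))) ≤
      c / lam * lam⁻¹ ^ n := fun n => by
    have hstep : T.symm^[n + 1] (u (n + 1)) - T.symm^[n] (u n) =
        T.symm^[n + 1] (u (n + 1) - T (u n)) := by
      rw [iterate_map_sub, Function.iterate_succ_apply _ _ (T (u n)), T.symm_apply_apply]
    rw [dist_comm, dist_eq_norm, hstep]
    calc ‖T.symm^[n + 1] (u (n + 1) - T (u n))‖
        ≤ ‖u (n + 1) - T (u n)‖ / lam ^ (n + 1) := norm_iterate_symm_le hlam₀ hT _ _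
      _ ≤ c / lam ^ (n + 1) := by gcongr; exact hu n
      _ = c / lam * lam⁻¹ ^ n := by rw [inv_pow, pow_succ', ← div_div, div_eq_mul_inv _ (lam ^ n)]
  have hinv : lam⁻¹ < 1 := inv_lt_one_of_one_lt₀ hlam
  obtain ⟨y, hy⟩ := cauchySeq_tendsto_of_complete (cauchySeq_of_le_geometric _ _ hinv hdist)
  refine ⟨y, hy, ?_⟩
  calc ‖u 0 - y‖ ≤ c / lam / (1 - lam⁻¹) := by
        simpa only [dist_eq_norm, Function.iterate_zero_apply] using
          dist_le_of_le_geometric_of_tendsto₀ _ _ hinv hdist hy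
    _ = c / (lam - 1) := by rw [div_div, mul_sub, mul_one, mul_inv_cancel₀ hlam₀.ne']

theorem existsUnique_forall_norm_sub_iterate_le (hlam : 1 < lam) (hT : ∀ v, lam * ‖v‖ ≤ ‖T v‖)
    {u : ℕ → E} (hu : ∀ n, ‖u (n + 1) - T (u n)‖ ≤ c) :
    ∃! y, ∀ n, ‖u n - T^[n] y‖ ≤ c / (lam - 1) := by
  have hlam₀ : 0 < lam := one_pos.trans hlam
  choose y hy hy_le using fun m => exists_tendsto_iterate_symm (u := fun n => u (n + m)) hlam hT
    fun n => by simpa only [add_right_comm] using hu (n + m)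
  have hcont : Continuous T.symm :=
    AddMonoidHomClass.continuous_of_bound T.symm lam⁻¹ fun v => by
      simpa [div_eq_inv_mul] using norm_iterate_symm_le hlam₀ hT 1 v
  have hyT : ∀ m, T.symm^[m] (y m) = y 0 := fun m => by
    refine tendsto_nhds_unique (((hcont.iterate m).tendsto _).comp (hy m)) ?_
    simpa only [Function.comp_def, ← Function.iterate_add_apply, add_comm m, add_zero] using
      (tendsto_add_atTop_iff_nat m).2 (hy 0)
  have hTy : ∀ m, T^[m] (y 0) = y m := fun m => by
    rw [← hyT m, Function.LeftInverse.iterate T.apply_symm_apply m]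
  refine ⟨y 0, fun n => ?_, fun w hw => ?_⟩
  · simpa only [hTy, zero_add] using hy_le n
  · refine eq_of_forall_norm_iterate_sub_le (c := c / (lam - 1) + c / (lam - 1)) hlam hT fun n => ?_
    refine (norm_sub_le_norm_sub_add_norm_sub _ (u n) _).trans (add_le_add ?_ ?_)
    · rw [norm_sub_rev]
      exact hw n
    · simpa only [hTy, zero_add] using hy_le n

end NormedGroup

theorem existsUnique_forall_seminorm_sub_iterate_le {E : Type*} [AddCommGroup E] [Module ℝ E]
    [FiniteDimensional ℝ E] (N : Seminorm ℝ E) (hN : ∀ v, N v = 0 → v = 0) {T : E ≃+ E}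
    {lam c : ℝ} (hlam : 1 < lam) (hT : ∀ v, lam * N v ≤ N (T v)) {u : ℕ → E}
    (hu : ∀ n, N (u (n + 1) - T (u n)) ≤ c) :
    ∃! y, ∀ n, N (u n - T^[n] y) ≤ c / (lam - 1) := by
  let _ : Norm E := ⟨N⟩
  have core : NormedSpace.Core ℝ E :=
    { norm_nonneg := apply_nonneg N
      norm_smul := map_smul_eq_mul N
      norm_triangle := map_add_le_add N
      norm_eq_zero_iff := fun v => ⟨hN v, fun hv => hv ▸ map_zero N⟩ }
  let _ : NormedAddCommGroup E := .ofCore core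
  let _ : NormedSpace ℝ E := .ofCore core
  have : CompleteSpace E := FiniteDimensional.complete ℝ E
  exact existsUnique_forall_norm_sub_iterate_le hlam hT hu

variable {b : ℕ} {A : Matrix (Fin b) (Fin b) ℤ} {N : Seminorm ℝ (Fin b → ℝ)} {lam : ℝ}

/-- The action of `A` on `ℝ^b` as an automorphism. -/
def actEquiv (hA : A.det ≠ 0) : (Fin b → ℝ) ≃+ (Fin b → ℝ) :=
  have := (isUnit_map_intCast ℝ hA).invertible
  (Matrix.toLinearEquiv' (A.map (Int.cast : ℤ → ℝ)) this).toAddEquiv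

theorem IsAdaptedNorm.mul_le_act (hN : IsAdaptedNorm A lam N) (hA : A.det ≠ 0) (hlam : 0 < lam)
    (v : Fin b → ℝ) : lam * N v ≤ N (act A v) := by
  obtain ⟨k, hk, hle⟩ := hN.contracting
  have hAv := hle (act A v)
  rw [act, Matrix.mulVec_mulVec, Matrix.nonsing_inv_mul _
    ((Matrix.isUnit_iff_isUnit_det _).1 (isUnit_map_intCast ℝ hA)), Matrix.one_mulVec] at hAv
  rw [← le_div_iff₀' hlam, div_eq_inv_mul, ← one_div]
  exact hAv.trans (mul_le_mul_of_nonneg_right hk.le (apply_nonneg _ _))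

theorem IsAdaptedNorm.existsUnique_shadow (hN : IsAdaptedNorm A lam N) (hA : A.det ≠ 0)
    (hlam : 1 < lam) {X : Type*} {iota : X → Fin b → ℝ} {F : X → X}
    (hbdd : BddAbove (range fun x => N (sigma iota F A x))) (x : X) :
    ∃! y, Shadow iota F A N (deltaConst iota F A N lam) x y :=
  existsUnique_forall_seminorm_sub_iterate_le N hN.definite (T := actEquiv hA) hlam
    (hN.mul_le_act hA (one_pos.trans hlam)) fun n => by
      rw [Function.iterate_succ_apply']
      exact le_ciSup hbdd (F^[n] x)

end Shadowing

/-! ### The displacement error -/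

section Displacement

variable {b m : ℕ} {M : Type u} [TopologicalSpace M] {M' : Type v} [TopologicalSpace M']
  {θ : Fin b → LocalPrimitives M} {Γ : Module.Basis (Fin b) ℤ (H1 M)}

theorem LocalPrimitives.Represents.period_eq [ChartedSpace (EuclideanSpace ℝ (Fin m)) M]
    {θ : LocalPrimitives M} {η : OneForm m M} (hθ : θ.Represents η) {c : H1 M} {r : ℝ}
    (hη : η.HasPeriod c r) : θ.period c = r := by
  obtain ⟨x, γ, hγ, rfl, rfl⟩ := hη
  rw [LocalPrimitives.period_loopClass, hθ.integral_eq hγ]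

theorem period_eq_repr (hdual : ∀ i j, (θ i).period (Γ j) = if i = j then 1 else 0) (i : Fin b)
    (c : H1 M) : (θ i).period c = Γ.repr c i := by
  have : (θ i).period = (Int.castAddHom ℝ).toIntLinearMap ∘ₗ Γ.coord i :=
    Γ.ext fun j => by simp [hdual, Finsupp.single_apply, eq_comm]
  exact LinearMap.congr_fun this c

theorem period_H1map (hdual : ∀ i j, (θ i).period (Γ j) = if i = j then 1 else 0) (f : C(M, M))
    (c : H1 M) : (fun i => (θ i).period (H1map f c)) =
      act (homologyMatrix Γ f) fun i => (θ i).period c := by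
  funext i
  simp only [period_eq_repr hdual, act, homologyMatrix]
  rw [← LinearMap.toMatrix_mulVec_repr Γ Γ (H1map f) c]
  exact RingHom.map_mulVec (Int.castRingHom ℝ) _ _ i

variable {p : C(M', M)} {iota : M' → Fin b → ℝ} {f : C(M, M)} {F : C(M', M')}

theorem sigma_eq_of_apply_eq [PathConnectedSpace M']
    (hdual : ∀ i j, (θ i).period (Γ j) = if i = j then 1 else 0)
    (hι : ∀ i, (θ i).IsPrimitive p fun x => iota x i) (hF : IsLift p f F) {x x' : M'}
    (hx : p x = p x') :
    sigma iota F (homologyMatrix Γ f) x = sigma iota F (homologyMatrix Γ f) x' := by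
  let γ : Path x x' := PathConnectedSpace.somePath x x'
  let δ : Path (p x) (p x) := (γ.map p.continuous).cast rfl hx
  have hδ : iota x' - iota x = fun i => (θ i).period (loopClass δ) := funext fun i => by
    have hpγ : p.comp (γ : C(unitInterval, M')) = δ := rfl
    rw [LocalPrimitives.period_loopClass, ← hpγ, (hι i).integral_comp]
    simp
  have hfδ : iota (F x') - iota (F x) = fun i => (θ i).period (H1map f (loopClass δ)) :=
    funext fun i => by
      have hpFγ : p.comp (F.comp (γ : C(unitInterval, M'))) = δ.map f.continuous :=
        ContinuousMap.ext fun t => hF (γ t)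
      rw [H1map_loopClass, LocalPrimitives.period_loopClass, ← hpFγ, (hι i).integral_comp]
      simp
  rw [period_H1map hdual, ← hδ, act, Matrix.mulVec_sub] at hfδ
  rw [sigma, sigma, sub_eq_sub_iff_sub_eq_sub, ← neg_sub, hfδ, neg_sub]
  rfl

theorem bddAbove_range_of_factorsThrough {X Y : Type*} [TopologicalSpace X] [TopologicalSpace Y]
    [CompactSpace Y] {p : C(X, Y)} (hp : IsQuotientMap p) (g : C(X, ℝ))
    (hgp : Function.FactorsThrough g p) : BddAbove (range g) := by
  rw [← hp.lift_comp g hgp, ContinuousMap.coe_comp]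
  exact (isCompact_range (hp.lift g hgp).continuous).bddAbove.mono (range_comp_subset_range _ _)

theorem bddAbove_seminorm_sigma [CompactSpace M] [PathConnectedSpace M'] (hp : IsQuotientMap p)
    (hdual : ∀ i j, (θ i).period (Γ j) = if i = j then 1 else 0)
    (hι : ∀ i, (θ i).IsPrimitive p fun x => iota x i) (hcont : Continuous iota)
    (hF : IsLift p f F) (N : Seminorm ℝ (Fin b → ℝ)) :
    BddAbove (range fun x => N (sigma iota F (homologyMatrix Γ f) x)) := by
  have hN : Continuous N := continuousOn_univ.1 (N.convexOn.continuousOn isOpen_univ)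
  have hact : Continuous (act (homologyMatrix Γ f)) := continuous_const.matrix_mulVec continuous_id
  refine bddAbove_range_of_factorsThrough hp
    ⟨_, hN.comp ((hcont.comp F.continuous).sub (hact.comp hcont))⟩ fun x x' hx => ?_
  exact congrArg N (sigma_eq_of_apply_eq hdual hι hF hx)

end Displacement

end GlobalShadowing

end

theorem mainTheorem4_general {b m : ℕ} {M : Type u} [TopologicalSpace M] [CompactSpace M]
    [ChartedSpace (EuclideanSpace ℝ (Fin m)) M] [IsManifold (𝓡 m) ∞ M]
    (Γ : Module.Basis (Fin b) ℤ (H1 M)) (η : Fin b → OneForm m M)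
    (hη : ∀ i, (η i).IsSmoothClosed)
    (hdual : ∀ i j, (η i).HasPeriod (Γ j) (if i = j then 1 else 0))
    {M' : Type v} [TopologicalSpace M'] [PathConnectedSpace M'] (p : C(M', M))
    (hp : IsLocalHomeomorph p) (hsurj : Function.Surjective p) (z : M')
    (hz : (FundamentalGroup.map p z).range ≤ commutator (FundamentalGroup M (p z)))
    (f : C(M, M)) (hf : IsExpanding (homologyMatrix Γ f)) (F : C(M', M')) (hF : IsLift p f F) :
    (∃ lam : ℝ, IsExpansionConstant (homologyMatrix Γ f) lam) ∧
    (∀ lam : ℝ, IsExpansionConstant (homologyMatrix Γ f) lam →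
      ∃ N : Seminorm ℝ (Fin b → ℝ), IsAdaptedNorm (homologyMatrix Γ f) lam N) ∧
    ∀ (lam : ℝ) (N : Seminorm ℝ (Fin b → ℝ)),
      IsExpansionConstant (homologyMatrix Γ f) lam →
      IsAdaptedNorm (homologyMatrix Γ f) lam N →
        BddAbove (Set.range fun x : M' => N (sigma (albanese p η z) F (homologyMatrix Γ f) x)) ∧
        (∀ x₀ : M', ∃! y : Fin b → ℝ,
          Shadow (albanese p η z) F (homologyMatrix Γ f) N
            (deltaConst (albanese p η z) F (homologyMatrix Γ f) N lam) x₀ y) ∧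
        (∀ (x₀ : M') (y : Fin b → ℝ),
          Shadow (albanese p η z) F (homologyMatrix Γ f) N
            (deltaConst (albanese p η z) F (homologyMatrix Γ f) N lam) x₀ y →
          GloballyShadow p (albanese p η z) f (toralEndo (homologyMatrix Γ f))
            (homologyMatrix Γ f) N
            (deltaConst (albanese p η z) F (homologyMatrix Γ f) N lam) (p x₀) (torusProj y)) ∧
        (∀ x : M, ∃ y : Fin b → UnitAddCircle,
          GloballyShadow p (albanese p η z) f (toralEndo (homologyMatrix Γ f))
            (homologyMatrix Γ f) N
            (deltaConst (albanese p η z) F (homologyMatrix Γ f) N lam) x y) := by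
  have hdet := hf.det_ne_zero
  refine ⟨hf.exists_isExpansionConstant, fun lam hlam => hlam.exists_isAdaptedNorm hdet,
    fun lam N hlam hN => ?_⟩
  choose θ hθ using fun i => (hη i).exists_represents
  have hperiod : ∀ i j, (θ i).period (Γ j) = if i = j then 1 else 0 := fun i j =>
    (hθ i).period_eq (hdual i j)
  have hbdd := bddAbove_seminorm_sigma (hp.isOpenMap.isQuotientMap p.continuous hsurj) hperiod
    (isPrimitive_albanese hp hz hθ) (continuous_albanese hp hz hθ) hF N
  have hex := hN.existsUnique_shadow hdet hlam.1 hbdd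
  refine ⟨hbdd, hex, fun x₀ y hy => ⟨isLift_act _, x₀, y, F, rfl, rfl, hF, hy⟩, fun x => ?_⟩
  obtain ⟨x₀, rfl⟩ := hsurj x
  obtain ⟨y, hy, -⟩ := hex x₀
  exact ⟨torusProj y, isLift_act _, x₀, y, F, rfl, rfl, hF, hy⟩

theorem mainTheorem4 {b m : ℕ} (hb : 0 < b)
    -- a compact connected smooth manifold with `H₁(M; ℤ)` free of rank `b`
    {M : Type u} [TopologicalSpace M] [T2Space M] [CompactSpace M] [ConnectedSpace M]
    [ChartedSpace (EuclideanSpace ℝ (Fin m)) M] [IsManifold (𝓡 m) ∞ M]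
    (Γ : Module.Basis (Fin b) ℤ (H1 M))
    -- closed one-forms dual to the basis
    (η : Fin b → OneForm m M) (hη : ∀ i, (η i).IsSmoothClosed)
    (hdual : ∀ i j, (η i).HasPeriod (Γ j) (if i = j then 1 else 0))
    -- the universal Abelian cover with a base point
    {M' : Type v} [TopologicalSpace M'] (p : C(M', M)) (hp : IsUniversalAbelianCover p) (z : M')
    -- an `H₁`-expanding map and a lift of it
    (f : C(M, M)) (hf : IsExpanding (homologyMatrix Γ f))
    (F : C(M', M')) (hF : IsLift p f F) :
    -- expansion constants and adapted norms exist
    (∃ lam : ℝ, IsExpansionConstant (homologyMatrix Γ f) lam) ∧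
    (∀ lam : ℝ, IsExpansionConstant (homologyMatrix Γ f) lam →
      ∃ N : Seminorm ℝ (Fin b → ℝ), IsAdaptedNorm (homologyMatrix Γ f) lam N) ∧
    -- for each choice of them, `c(f)` is finite and the shadowing statement holds
    ∀ (lam : ℝ) (N : Seminorm ℝ (Fin b → ℝ)),
      IsExpansionConstant (homologyMatrix Γ f) lam →
      IsAdaptedNorm (homologyMatrix Γ f) lam N →
        BddAbove (Set.range fun x : M' => N (sigma (albanese p η z) F (homologyMatrix Γ f) x)) ∧
        (∀ x₀ : M', ∃! y : Fin b → ℝ,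
          Shadow (albanese p η z) F (homologyMatrix Γ f) N
            (deltaConst (albanese p η z) F (homologyMatrix Γ f) N lam) x₀ y) ∧
        (∀ (x₀ : M') (y : Fin b → ℝ),
          Shadow (albanese p η z) F (homologyMatrix Γ f) N
            (deltaConst (albanese p η z) F (homologyMatrix Γ f) N lam) x₀ y →
          GloballyShadow p (albanese p η z) f (toralEndo (homologyMatrix Γ f))
            (homologyMatrix Γ f) N
            (deltaConst (albanese p η z) F (homologyMatrix Γ f) N lam) (p x₀) (torusProj y)) ∧
        (∀ x : M, ∃ y : Fin b → UnitAddCircle,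
          GloballyShadow p (albanese p η z) f (toralEndo (homologyMatrix Γ f))
            (homologyMatrix Γ f) N
            (deltaConst (albanese p η z) F (homologyMatrix Γ f) N lam) x y) := by
  have := hp.pathConnected
  exact mainTheorem4_general Γ η hη hdual p hp.covering.isLocalHomeomorph hp.surjective z
    (hp.range_eq z).le f hf F hF
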